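/- **Setting.** Let $(E,\mathcal B)$ be a measurable space and let $\nu=\nu_0,\nu_1,\nu_2,\dots$ be probability measures on it that are carried by pairwise disjoint measurable sets $E_n$, i.e. $\nu_n(E\setminus E_n)=0$. Let $\alpha_n>0$, $\sum_{n\ge 0}\alpha_n=1$, and $\mathbb M=\sum_{n\ge0}\alpha_n\nu_n$. All functions are real-valued, $\bigcap_{n\ge0}L^2(E,\nu_n)$ is the space of classes, modulo equality $\mathbb M$-a.e., of measurable functions that are square integrable with respect to every $\nu_n$, $\langle\cdot,\cdot\rangle_n$ is the inner product of $L^2(E,\nu_n)$, $n\ge1$, and $\langle\cdot,\cdot\rangle$ is that of $L^2(E,\nu)$. Put $$\mathcal D=\Big\{\varphi\in\bigcap_{n\ge0}L^2(E,\nu_n):\ \langle\varphi,\varphi\rangle_n\to\langle\varphi,\varphi\rangle\ (n\to\infty)\Big\},$$ let $\mathcal F\subseteq\mathcal D$ be a linear subspace that is dense in $L^2(E,\nu)$, and let $\mathcal C$ be the set of all $\varphi\in\mathcal D$ such that * (c1) there are $\varphi_n\in\mathcal F$, $n\ge1$, with $\varphi=\varphi_n$ $\nu_n$-a.e. for every $n\ge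 1$, and * (c2) $\langle\varphi,\psi\rangle_n\to\langle\varphi,\psi\rangle$ as $n\to\infty$ for all $\psi\in\mathcal F$. An element of $L^2(E,\nu_n)$, $n\ge 0$, is said to be in $\mathcal C$ if it equals $\nu_n$-a.e. some element of $\mathcal C$. For $\psi_n\in L^2(E,\nu_n)$, $n\ge1$, all in $\mathcal C$ in this sense, and $\psi\in L^2(E,\nu)$, we say that $\psi_n$ *s-converges* to $\psi$ if $\langle\psi_n,\rho\rangle_n\to\langle\psi,\rho\rangle$ for all $\rho\in\mathcal C$ and $\langle\psi_n,\psi_n\rangle_n\to\langle\psi,\psi\rangle$ as $n\to\infty$. Let $(T_{n,t})_{t\ge0}$, $n\ge1$, be strongly continuous contraction semigroups on $L^2(E,\nu_n)$ and $(T_t)_{t\ge0}$ one on $L^2(E,\nu)$. For $\beta>0$ let $G_{n,\beta}f=\int_0^\infty e^{-\beta t}T_{n,t}f\,dt$ and $G_\beta f=\int_0^\infty e^{-\beta t}T_tf\,dt$ be their resolvents. A prime denotes the adjoint operator. **Theorem.** Suppose that, in the above sense, * (c3) for all $g\in\mathcal C$, $\beta>0$ and $n\ge1$, the elements $G_\beta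 g,\ G_{n,\beta}g,\ G_\beta'g,\ G_{n,\beta}'g$ are in $\mathcal C$; * (c5) for all $g\in\mathcal C$, $t>0$ and $n\ge1$, the elements $T_tg,\ T_{n,t}g,\ T_t'g,\ T_{n,t}'g$ are in $\mathcal C$. Then: 1. For every $g\in\mathcal C$: $G_{n,\beta}g$ s-converges to $G_\beta g$ for all $\beta>0$ if and only if $T_{n,t}g$ s-converges to $T_tg$ for all $t\ge0$. 2. For every $\beta>0$: $G_{n,\beta}g$ s-converges to $G_\beta g$ for all $g\in\mathcal C$ if and only if $T_{n,t}g$ s-converges to $T_tg$ for all $g\in\mathcal C$ and all $t\ge0$. 3. Statements 1 and 2 also hold with $G'_{n,\beta},G'_\beta,T'_{n,t},T'_t$ in place of $G_{n,\beta},G_\beta,T_{n,t},T_t$. -/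

import Mathlib

open MeasureTheory Filter Topology Set
open scoped NNReal ENNReal

noncomputable section

/-- Probability measures `ν 0, ν 1, ν 2, …` on a measurable space `E`, carried by pairwise disjoint
measurable sets (so they are mutually orthogonal), and positive weights with sum `1`.
The measure `ν 0` is the limiting one, the measures `ν n`, `n ≥ 1`, form the sequence. -/
structure MeasureSequence (E : Type*) [MeasurableSpace E] where
  ν : ℕ → Measure E
  isProbabilityMeasure : ∀ n, IsProbabilityMeasure (ν n)
  carrier : ℕ → Set E
  measurableSet_carrier : ∀ n, MeasurableSet (carrier n)
  disjoint_carrier : Pairwise fun m n => Disjoint (carrier m) (carrier n)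
  measure_compl_carrier : ∀ n, ν n (carrier n)ᶜ = 0
  α : ℕ → ℝ
  α_pos : ∀ n, 0 < α n
  hasSum_α : HasSum α 1

namespace MeasureSequence

variable {E : Type*} [MeasurableSpace E] (S : MeasureSequence E)

instance (n : ℕ) : IsProbabilityMeasure (S.ν n) := S.isProbabilityMeasure n

/-- The mixture `∑ₙ αₙ νₙ`. -/
def mix : Measure E := Measure.sum fun n => ENNReal.ofReal (S.α n) • S.ν n

theorem absolutelyContinuous_mix (n : ℕ) : S.ν n ≪ S.mix := by
  refine Measure.AbsolutelyContinuous.mk fun s hs h => ?_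
  rw [mix, Measure.sum_apply _ hs, ENNReal.tsum_eq_zero] at h
  have h1 := h n
  rw [Measure.smul_apply, smul_eq_mul, mul_eq_zero] at h1
  rcases h1 with h1 | h1
  · exact absurd (ENNReal.ofReal_eq_zero.1 h1) (not_le.2 (S.α_pos n))
  · exact h1

/-- The real Hilbert space `L²(E, νₙ)`. -/
abbrev L2 (n : ℕ) : Type _ := Lp ℝ 2 (S.ν n)

/-- The intersection of all the spaces `L²(E, νₙ)`, `n ≥ 0`: classes of measurable functions modulo
equality almost everywhere with respect to the mixture, square integrable for every `νₙ`. -/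
def interL2 : Submodule ℝ (E →ₘ[S.mix] ℝ) where
  carrier := {u | ∀ n, MemLp u 2 (S.ν n)}
  add_mem' := fun {u v} hu hv n => ((hu n).add (hv n)).ae_eq
    ((S.absolutelyContinuous_mix n).ae_eq (AEEqFun.coeFn_add u v)).symm
  zero_mem' := fun n => (MemLp.zero' (ε := ℝ)).ae_eq
    ((S.absolutelyContinuous_mix n).ae_eq (AEEqFun.coeFn_zero (μ := S.mix) (β := ℝ))).symm
  smul_mem' := fun c u hu n => ((hu n).const_smul c).ae_eq
    ((S.absolutelyContinuous_mix n).ae_eq (AEEqFun.coeFn_smul c u)).symm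

/-- The class in `L²(E, νₙ)` of an element of the intersection. -/
def toL2 (n : ℕ) : S.interL2 →ₗ[ℝ] S.L2 n where
  toFun u := (u.2 n).toLp u.1
  map_add' u v := by
    rw [← MemLp.toLp_add]
    exact MemLp.toLp_congr _ _
      ((S.absolutelyContinuous_mix n).ae_eq (AEEqFun.coeFn_add u.1 v.1))
  map_smul' c u := by
    rw [RingHom.id_apply, ← MemLp.toLp_const_smul]
    exact MemLp.toLp_congr _ _
      ((S.absolutelyContinuous_mix n).ae_eq (AEEqFun.coeFn_smul c u.1))

/-- The set `𝒟` of all `φ` with `⟨φ, φ⟩ₙ → ⟨φ, φ⟩`. -/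
def D : Set S.interL2 :=
  {φ | Tendsto (fun n => inner ℝ (S.toL2 n φ) (S.toL2 n φ)) atTop
    (𝓝 (inner ℝ (S.toL2 0 φ) (S.toL2 0 φ)))}

/-- The set `𝒞` of all `φ ∈ 𝒟` which, for every `n ≥ 1`, agree `νₙ`-a.e. with some element `φₙ`
of `ℱ` and satisfy `⟨φ, ψ⟩ₙ → ⟨φ, ψ⟩` for every `ψ ∈ ℱ`. -/
def C (F : Submodule ℝ S.interL2) : Set S.interL2 :=
  {φ | φ ∈ S.D ∧
    (∃ r : ℕ → S.interL2, ∀ n, 1 ≤ n → r n ∈ F ∧ S.toL2 n φ = S.toL2 n (r n)) ∧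
    (∀ ψ ∈ F, Tendsto (fun n => inner ℝ (S.toL2 n φ) (S.toL2 n ψ)) atTop
      (𝓝 (inner ℝ (S.toL2 0 φ) (S.toL2 0 ψ))))}

/-- The element `x` of `L²(E, νₙ)` belongs to `𝒞`, in the sense that it agrees `νₙ`-a.e. with some
element of `𝒞`. -/
def InC (F : Submodule ℝ S.interL2) (n : ℕ) (x : S.L2 n) : Prop :=
  ∃ u ∈ S.C F, S.toL2 n u = x

/-- w-convergence of `ψₙ ∈ 𝒞`, `n ≥ 1`, considered in `L²(E, νₙ)`, to `x ∈ L²(E, ν₀)`. -/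
def WConv (F : Submodule ℝ S.interL2) (ψ : ∀ n, S.L2 n) (x : S.L2 0) : Prop :=
  (∀ n, 1 ≤ n → S.InC F n (ψ n)) ∧
  ∀ ρ ∈ S.C F, Tendsto (fun n => inner ℝ (ψ n) (S.toL2 n ρ)) atTop
    (𝓝 (inner ℝ x (S.toL2 0 ρ)))

/-- s-convergence of `ψₙ ∈ 𝒞`, `n ≥ 1`, considered in `L²(E, νₙ)`, to `x ∈ L²(E, ν₀)`. -/
def SConv (F : Submodule ℝ S.interL2) (ψ : ∀ n, S.L2 n) (x : S.L2 0) : Prop :=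
  S.WConv F ψ x ∧ Tendsto (fun n => inner ℝ (ψ n) (ψ n)) atTop (𝓝 (inner ℝ x x))

end MeasureSequence

/-- Strongly continuous contraction semigroups on a real Hilbert space. -/
structure ContractionSemigroup (H : Type*) [NormedAddCommGroup H] [InnerProductSpace ℝ H] where
  op : ℝ≥0 → H →L[ℝ] H
  op_zero : op 0 = ContinuousLinearMap.id ℝ H
  op_add : ∀ s t, op (s + t) = (op s).comp (op t)
  norm_op_le : ∀ t, ‖op t‖ ≤ 1
  continuous_op : ∀ x, Continuous fun t => op t x

namespace ContractionSemigroup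

variable {H : Type*} [NormedAddCommGroup H] [InnerProductSpace ℝ H]
  (T : ContractionSemigroup H)

theorem norm_laplace_le (β : ℝ) (x : H) (t : ℝ) :
    ‖Real.exp (-β * t) • T.op t.toNNReal x‖ ≤ ‖x‖ * Real.exp (-β * t) := by
  rw [norm_smul, Real.norm_eq_abs, Real.abs_exp, mul_comm]
  gcongr
  simpa using (T.op t.toNNReal).le_of_opNorm_le (T.norm_op_le _) x

theorem integrableOn_laplace {β : ℝ} (hβ : 0 < β) (x : H) :
    IntegrableOn (fun t : ℝ => Real.exp (-β * t) • T.op t.toNNReal x) (Ioi 0) := by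
  refine Integrable.mono' (g := fun t => ‖x‖ * Real.exp (-β * t))
    ((exp_neg_integrableOn_Ioi 0 hβ).const_mul _) ?_ (ae_of_all _ (T.norm_laplace_le β x))
  have h := (T.continuous_op x).comp continuous_real_toNNReal
  exact Continuous.aestronglyMeasurable (by fun_prop)

variable [CompleteSpace H]

/-- The resolvent `G_β x = ∫₀^∞ e^{-βt} T_t x dt`, `β > 0`. -/
def resolvent (β : ℝ) (hβ : 0 < β) : H →L[ℝ] H :=
  LinearMap.mkContinuous
    { toFun := fun x => ∫ t in Ioi (0 : ℝ), Real.exp (-β * t) • T.op t.toNNReal x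
      map_add' := fun x y => by
        simp only [map_add, smul_add]
        exact integral_add (T.integrableOn_laplace hβ x) (T.integrableOn_laplace hβ y)
      map_smul' := fun c x => by
        simp only [map_smul, RingHom.id_apply, smul_comm _ c]
        exact integral_smul c _ }
    (∫ t in Ioi (0 : ℝ), Real.exp (-β * t)) (fun x => by
      rw [mul_comm, ← integral_const_mul]
      exact norm_integral_le_of_norm_le ((exp_neg_integrableOn_Ioi 0 hβ).const_mul _)
        (ae_of_all _ (T.norm_laplace_le β x)))

end ContractionSemigroup

end

/-! Regard `F` as a common space mapped into every L²(νₙ). On `F` the norms converge to the limit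
norm, and the image in L²(ν₀) is dense. A sequence then converges strongly if elements of `F`
approximate it in the limit space and, eventually, in the n-th space. On sequences in 𝒞 this is
s-convergence (`sConv_iff`), so everything reduces to a Trotter–Kato theorem for varying Hilbert
spaces.

From semigroups to resolvents (`resolvent_of_semigroup`): Laplace transforms of inner products give
weak convergence, and pairing weak with strong limits gives the norms. From resolvents to semigroups
(`semigroup_of_resolvent`): by Weierstrass, integrals of orbits against e⁻ᵗq(e⁻ᵗ) are limits of
combinations of resolvents. A kernel concentrated near t recovers Tₜ, since convergence of βGβx - x
makes the orbits eventually almost equicontinuous. The resolvent equation passes from one β to all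
(`resolvent_of_resolvent`). The adjoint case is the same theorem for the semigroups `dual`. -/

/-! ### Strong convergence along varying Hilbert spaces -/

section StrongConvergence

variable {H : ℕ → Type*} [∀ n, NormedAddCommGroup (H n)] [∀ n, InnerProductSpace ℝ (H n)]
  {V : Type*} [AddCommGroup V] [Module ℝ V] (J : ∀ n, V →ₗ[ℝ] H n)

/-- Strong convergence of `x n` to `x 0` along varying Hilbert spaces which are compared by means
of the maps `J n` defined on a common space. -/
def StrongConv (x : ∀ n, H n) : Prop :=
  ∀ ε : ℝ, 0 < ε → ∃ u : V, ‖x 0 - J 0 u‖ < ε ∧ ∀ᶠ n in atTop, ‖x n - J n u‖ < ε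

/-- The maps `J n` are asymptotically isometric with respect to `J 0`, which has dense range. -/
structure AsymptoticIsometry : Prop where
  tendsto_norm : ∀ u, Tendsto (fun n => ‖J n u‖) atTop (𝓝 ‖J 0 u‖)
  denseRange : DenseRange (J 0)

variable {J}

theorem strongConv_apply (u : V) : StrongConv J (fun n => J n u) := fun ε hε =>
  ⟨u, by simpa using hε, Eventually.of_forall fun n => by simpa using hε⟩

namespace StrongConv

variable {x y : ∀ n, H n}

/-- The approximating sequence may depend on ε, which admits polynomial kernels, tent averages and
Neumann iterates. -/
theorem of_approx (h : ∀ ε : ℝ, 0 < ε → ∃ y : ∀ n, H n, StrongConv J y ∧ ‖x 0 - y 0‖ ≤ ε ∧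
    ∀ᶠ n in atTop, ‖x n - y n‖ ≤ ε) : StrongConv J x := by
  intro ε hε
  obtain ⟨y, hy, h0, h1⟩ := h (ε / 2) (half_pos hε)
  obtain ⟨u, hu0, hu1⟩ := hy (ε / 2) (half_pos hε)
  refine ⟨u, ?_, ?_⟩
  · linarith [norm_sub_le_norm_sub_add_norm_sub (x 0) (y 0) (J 0 u)]
  · filter_upwards [h1, hu1] with n hn hn'
    linarith [norm_sub_le_norm_sub_add_norm_sub (x n) (y n) (J n u)]

theorem add (hx : StrongConv J x) (hy : StrongConv J y) :
    StrongConv J (fun n => x n + y n) := by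
  intro ε hε
  obtain ⟨u, hu0, hu1⟩ := hx (ε / 2) (half_pos hε)
  obtain ⟨v, hv0, hv1⟩ := hy (ε / 2) (half_pos hε)
  have key : ∀ n, ‖x n + y n - J n (u + v)‖ ≤ ‖x n - J n u‖ + ‖y n - J n v‖ := fun n => by
    rw [map_add, add_sub_add_comm]
    exact norm_add_le _ _
  refine ⟨u + v, (key 0).trans_lt (by linarith), ?_⟩
  filter_upwards [hu1, hv1] with n hn hn'
  exact (key n).trans_lt (by linarith)

theorem smul (c : ℝ) (hx : StrongConv J x) : StrongConv J (fun n => c • x n) := by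
  intro ε hε
  have hc : 0 < |c| + 1 := by positivity
  obtain ⟨u, hu0, hu1⟩ := hx (ε / (|c| + 1)) (by positivity)
  have key : ∀ n, ‖x n - J n u‖ < ε / (|c| + 1) → ‖c • x n - J n (c • u)‖ < ε := fun n hn => by
    rw [map_smul, ← smul_sub, norm_smul, Real.norm_eq_abs]
    rw [lt_div_iff₀ hc] at hn
    nlinarith [norm_nonneg (x n - J n u)]
  exact ⟨c • u, key 0 hu0, hu1.mono fun n hn => key n hn⟩

theorem sub (hx : StrongConv J x) (hy : StrongConv J y) :
    StrongConv J (fun n => x n - y n) := by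
  simpa [sub_eq_add_neg] using hx.add (hy.smul (-1))

theorem sum {ι : Type*} (s : Finset ι) {x : ι → ∀ n, H n} (hx : ∀ i ∈ s, StrongConv J (x i)) :
    StrongConv J (fun n => ∑ i ∈ s, x i n) := by
  classical
  induction s using Finset.induction_on with
  | empty => simpa using strongConv_apply (J := J) 0
  | insert a s ha ih =>
    simp only [Finset.sum_insert ha]
    exact (hx a (by simp)).add (ih fun i hi => hx i (by simp [hi]))

/-- A bound uniform in n carries the approximation of `x` by `J n u` through the operators. -/
theorem comp {A : ∀ n, H n →L[ℝ] H n} {M : ℝ} (hM : ∀ n z, ‖A n z‖ ≤ M * ‖z‖)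
    (hA : ∀ u, StrongConv J fun n => A n (J n u)) (hx : StrongConv J x) :
    StrongConv J fun n => A n (x n) := by
  refine of_approx fun ε hε => ?_
  have hc : 0 < |M| + 1 := by positivity
  obtain ⟨u, hu0, hu1⟩ := hx (ε / (|M| + 1)) (by positivity)
  have key : ∀ n, ‖x n - J n u‖ < ε / (|M| + 1) → ‖A n (x n) - A n (J n u)‖ ≤ ε := fun n hn => by
    rw [← map_sub]
    rw [lt_div_iff₀ hc] at hn
    nlinarith [norm_nonneg (x n - J n u), hM n (x n - J n u), le_abs_self M]
  exact ⟨_, hA u, key 0 hu0, hu1.mono fun n hn => key n hn⟩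

variable (hJ : AsymptoticIsometry J)
include hJ

theorem tendsto_norm (hx : StrongConv J x) : Tendsto (fun n => ‖x n‖) atTop (𝓝 ‖x 0‖) := by
  rw [Metric.tendsto_nhds]
  intro ε hε
  obtain ⟨u, hu0, hu1⟩ := hx (ε / 3) (by positivity)
  filter_upwards [hu1, Metric.tendsto_nhds.1 (hJ.tendsto_norm u) (ε / 3) (by positivity)] with n h1 h2
  rw [Real.dist_eq] at h2 ⊢
  have h3 := abs_norm_sub_norm_le (x n) (J n u)
  have h4 := abs_norm_sub_norm_le (x 0) (J 0 u)
  rw [abs_le] at h3 h4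
  rw [abs_lt] at h2 ⊢
  constructor <;> linarith

/-- Polarization reduces this to norms of the sum and the difference. -/
theorem tendsto_inner (hx : StrongConv J x) (hy : StrongConv J y) :
    Tendsto (fun n => inner ℝ (x n) (y n)) atTop (𝓝 (inner ℝ (x 0) (y 0))) := by
  have h1 := (hx.add hy).tendsto_norm hJ
  have h2 := (hx.sub hy).tendsto_norm hJ
  have key : ∀ n, inner ℝ (x n) (y n)
      = (‖x n + y n‖ * ‖x n + y n‖ - ‖x n - y n‖ * ‖x n - y n‖) / 4 := fun n =>
    re_inner_eq_norm_add_mul_self_sub_norm_sub_mul_self_div_four (𝕜 := ℝ) (x n) (y n)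
  simp only [key]
  exact ((h1.mul h1).sub (h2.mul h2)).div_const 4

omit hJ in
/-- Pairing of a strongly with a bounded weakly convergent sequence. -/
theorem tendsto_inner_of_weak (hx : StrongConv J x) {K : ℝ} (hK : ∀ᶠ n in atTop, ‖y n‖ ≤ K)
    (hK0 : ‖y 0‖ ≤ K)
    (hy : ∀ u, Tendsto (fun n => inner ℝ (y n) (J n u)) atTop (𝓝 (inner ℝ (y 0) (J 0 u)))) :
    Tendsto (fun n => inner ℝ (y n) (x n)) atTop (𝓝 (inner ℝ (y 0) (x 0))) := by
  have hK' : 0 ≤ K := (norm_nonneg _).trans hK0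
  rw [Metric.tendsto_nhds]
  intro ε hε
  have hc : 0 < 3 * (K + 1) := by positivity
  obtain ⟨u, hu0, hu1⟩ := hx (ε / (3 * (K + 1))) (by positivity)
  have key : ∀ n, ‖y n‖ ≤ K → ‖x n - J n u‖ < ε / (3 * (K + 1)) →
      |inner ℝ (y n) (x n) - inner ℝ (y n) (J n u)| < ε / 3 := fun n h h' => by
    rw [← inner_sub_right]
    refine (abs_real_inner_le_norm _ _).trans_lt ?_
    rw [lt_div_iff₀ hc] at h'
    nlinarith [norm_nonneg (x n - J n u), norm_nonneg (y n)]
  filter_upwards [hK, hu1, Metric.tendsto_nhds.1 (hy u) (ε / 3) (by positivity)] with n h1 h2 h3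
  have h4 := key n h1 h2
  have h5 := key 0 hK0 hu0
  rw [Real.dist_eq] at h3 ⊢
  rw [abs_lt] at h3 h4 h5 ⊢
  constructor <;> linarith

/-- Choose `u` by density in the limit space; expanding the square shows that ‖x n - J n u‖
converges to ‖x 0 - J 0 u‖. -/
theorem of_weak_of_norm
    (hx : ∀ u, Tendsto (fun n => inner ℝ (x n) (J n u)) atTop (𝓝 (inner ℝ (x 0) (J 0 u))))
    (hn : Tendsto (fun n => inner ℝ (x n) (x n)) atTop (𝓝 (inner ℝ (x 0) (x 0)))) :
    StrongConv J x := by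
  intro ε hε
  obtain ⟨u, hu⟩ := hJ.denseRange.exists_dist_lt (x 0) hε
  rw [dist_eq_norm] at hu
  refine ⟨u, hu, ?_⟩
  have h : Tendsto (fun n => ‖x n - J n u‖ ^ 2) atTop (𝓝 (‖x 0 - J 0 u‖ ^ 2)) := by
    simp only [norm_sub_sq_real, ← real_inner_self_eq_norm_sq (x _)]
    exact (hn.sub ((hx u).const_mul 2)).add ((hJ.tendsto_norm u).pow 2)
  have h2 : ‖x 0 - J 0 u‖ ^ 2 < ε ^ 2 := by gcongr
  exact (h.eventually_lt_const h2).mono fun n hn => lt_of_pow_lt_pow_left₀ 2 hε.le hn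

end StrongConv

attribute [irreducible] StrongConv

end StrongConvergence

/-! ### Resolvent calculus of a single contraction semigroup -/

namespace ContractionSemigroup

section Basic

variable {H : Type*} [NormedAddCommGroup H] [InnerProductSpace ℝ H]
  (T : ContractionSemigroup H)

theorem norm_op_apply_le (t : ℝ≥0) (x : H) : ‖T.op t x‖ ≤ ‖x‖ := by
  simpa using (T.op t).le_of_opNorm_le (T.norm_op_le t) x

theorem continuous_op_toNNReal (x : H) : Continuous fun t : ℝ => T.op t.toNNReal x :=
  (T.continuous_op x).comp continuous_real_toNNReal

theorem op_toNNReal_add {s t : ℝ} (hs : 0 ≤ s) (ht : 0 ≤ t) (x : H) :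
    T.op (s + t).toNNReal x = T.op s.toNNReal (T.op t.toNNReal x) := by
  rw [Real.toNNReal_add hs ht, T.op_add]; rfl

theorem resolvent_apply {β : ℝ} (hβ : 0 < β) (x : H) :
    T.resolvent β hβ x = ∫ t in Ioi (0 : ℝ), Real.exp (-β * t) • T.op t.toNNReal x := rfl

theorem integral_exp_neg_mul {β : ℝ} (hβ : 0 < β) :
    ∫ t in Ioi (0 : ℝ), Real.exp (-β * t) = β⁻¹ := by
  rw [integral_exp_mul_Ioi (by linarith)]
  simp [neg_div_neg_eq]

theorem norm_resolvent_le {β : ℝ} (hβ : 0 < β) (x : H) :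
    ‖T.resolvent β hβ x‖ ≤ β⁻¹ * ‖x‖ := by
  rw [← integral_exp_neg_mul hβ]
  exact (T.resolvent β hβ).le_of_opNorm_le (LinearMap.mkContinuous_norm_le _
    (integral_nonneg fun t => (Real.exp_pos _).le) _) x

end Basic
end ContractionSemigroup

namespace ContractionSemigroup

section Resolvent

variable {H : Type*} [NormedAddCommGroup H] [InnerProductSpace ℝ H]
  (T : ContractionSemigroup H)

theorem continuous_laplace (β : ℝ) (x : H) :
    Continuous fun t : ℝ => Real.exp (-β * t) • T.op t.toNNReal x := by
  have := T.continuous_op_toNNReal x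
  fun_prop

variable [CompleteSpace H]

theorem inner_resolvent {β : ℝ} (hβ : 0 < β) (x z : H) :
    inner ℝ (T.resolvent β hβ x) z
      = ∫ t in Ioi (0 : ℝ), Real.exp (-β * t) * inner ℝ (T.op t.toNNReal x) z := by
  rw [real_inner_comm, resolvent_apply, ← integral_inner (T.integrableOn_laplace hβ x)]
  simp only [inner_smul_right, real_inner_comm]

/-- The substitution s = βt turns βGβx into ∫ e⁻ˢ T(s/β)x ds, which tends to x by dominated
convergence. -/
theorem exists_norm_smul_resolvent_sub_lt (x : H) {ε : ℝ} (hε : 0 < ε) :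
    ∃ (β : ℝ) (hβ : 0 < β), ‖β • T.resolvent β hβ x - x‖ < ε := by
  have h : Tendsto (fun β : ℝ => ∫ s in Ioi (0 : ℝ), Real.exp (-1 * s) • T.op (s / β).toNNReal x)
      atTop (𝓝 (∫ s in Ioi (0 : ℝ), Real.exp (-1 * s) • x)) := by
    refine tendsto_integral_filter_of_dominated_convergence (fun s => ‖x‖ * Real.exp (-1 * s))
      (Eventually.of_forall fun β => ?_) (Eventually.of_forall fun β => ae_of_all _ fun s => ?_)
      ((exp_neg_integrableOn_Ioi 0 one_pos).const_mul _) (ae_of_all _ fun s => ?_)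
    · have := (T.continuous_op_toNNReal x).comp (continuous_id.div_const β)
      exact Continuous.aestronglyMeasurable (by fun_prop)
    · rw [norm_smul, Real.norm_eq_abs, Real.abs_exp, mul_comm]
      gcongr
      exact T.norm_op_apply_le _ _
    · refine Tendsto.const_smul ?_ _
      have h1 := ((T.continuous_op_toNNReal x).tendsto 0).comp
        (tendsto_const_nhds.div_atTop tendsto_id : Tendsto (fun β : ℝ => s / β) atTop (𝓝 0))
      simpa [T.op_zero, Function.comp_def] using h1
  rw [integral_smul_const, integral_exp_neg_mul one_pos, inv_one, one_smul] at h
  obtain ⟨β, h1, hβ⟩ := ((Metric.tendsto_nhds.1 h ε hε).and (eventually_gt_atTop 0)).exists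
  refine ⟨β, hβ, ?_⟩
  have h2 := integral_comp_mul_left_Ioi (fun s => Real.exp (-1 * s) • T.op (s / β).toNNReal x) 0 hβ
  rw [mul_zero] at h2
  simp only [mul_div_cancel_left₀ _ hβ.ne'] at h2
  rw [dist_eq_norm, ← smul_inv_smul₀ hβ.ne' (∫ s in Ioi (0 : ℝ), _), ← h2] at h1
  simpa only [resolvent_apply, neg_mul, one_mul] using h1

/-- Splitting the Laplace integral at `s` and translating leaves a formula differentiable in `s`, so
no generator is needed. -/
theorem op_resolvent {β : ℝ} (hβ : 0 < β) (x : H) {s : ℝ} (hs : 0 ≤ s) :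
    T.op s.toNNReal (T.resolvent β hβ x) = Real.exp (β * s) • (T.resolvent β hβ x
      - ∫ t in (0 : ℝ)..s, Real.exp (-β * t) • T.op t.toNNReal x) := by
  have h1 := intervalIntegral.integral_interval_add_Ioi (T.integrableOn_laplace hβ x)
    ((T.integrableOn_laplace hβ x).mono_set (Ioi_subset_Ioi hs))
  rw [resolvent_apply, sub_eq_of_eq_add' h1.symm,
    ← ContinuousLinearMap.integral_comp_comm _ (T.integrableOn_laplace hβ x), ← integral_smul]
  have h2 := (measurePreserving_add_left volume s).setIntegral_preimage_emb
    (measurableEmbedding_addLeft s)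
    (fun t => Real.exp (β * s) • Real.exp (-β * t) • T.op t.toNNReal x) (Ioi s)
  have h3 : (fun t => s + t) ⁻¹' Ioi s = Ioi (0 : ℝ) := by ext; simp
  rw [← h2, h3]
  refine setIntegral_congr_fun measurableSet_Ioi fun t ht => ?_
  simp only [map_smul]
  rw [T.op_toNNReal_add hs (le_of_lt ht), smul_smul, ← Real.exp_add]
  congr 2
  ring

theorem hasDerivWithinAt_op_resolvent {β : ℝ} (hβ : 0 < β) (x : H) {s : ℝ} (hs : 0 ≤ s) :
    HasDerivWithinAt (fun s : ℝ => T.op s.toNNReal (T.resolvent β hβ x))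
      (β • T.op s.toNNReal (T.resolvent β hβ x) - T.op s.toNNReal x) (Ici 0) s := by
  have h1 : HasDerivAt (fun s => ∫ t in (0 : ℝ)..s, Real.exp (-β * t) • T.op t.toNNReal x)
      (Real.exp (-β * s) • T.op s.toNNReal x) s :=
    ((T.continuous_laplace β x).integral_hasStrictDerivAt 0 s).hasDerivAt
  have h2 : HasDerivAt (fun s => Real.exp (β * s)) (Real.exp (β * s) * β) s := by
    simpa using ((hasDerivAt_id s).const_mul β).exp
  have h3 := (h2.smul (h1.const_sub (T.resolvent β hβ x))).hasDerivWithinAt (s := Ici 0)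
  refine (h3.congr_of_mem (fun u hu => T.op_resolvent hβ x hu) hs).congr_deriv ?_
  have h4 : Real.exp (β * s) * Real.exp (-β * s) = 1 := by
    rw [← Real.exp_add]; simp
  rw [T.op_resolvent hβ x hs, smul_neg, smul_smul, h4, one_smul, smul_smul, mul_comm _ β,
    neg_add_eq_sub]

/-- The derivative of the orbit is Tᵤ(βGβx - x), bounded by contractivity. -/
theorem norm_op_resolvent_sub_le {β : ℝ} (hβ : 0 < β) (x : H) {s t : ℝ} (hs : 0 ≤ s)
    (ht : 0 ≤ t) : ‖T.op t.toNNReal (T.resolvent β hβ x) - T.op s.toNNReal (T.resolvent β hβ x)‖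
      ≤ ‖β • T.resolvent β hβ x - x‖ * |t - s| :=
  (convex_Ici (0 : ℝ)).norm_image_sub_le_of_norm_hasDerivWithin_le
    (fun _ hu => T.hasDerivWithinAt_op_resolvent hβ x hu)
    (fun u _ => by
      rw [← map_smul, ← map_sub]
      exact T.norm_op_apply_le _ _) hs ht

/-- The resolvent equation. -/
theorem resolvent_add_smul_resolvent {β γ : ℝ} (hβ : 0 < β) (hγ : 0 < γ) (x : H) :
    T.resolvent β hβ (x + (β - γ) • T.resolvent γ hγ x) = T.resolvent γ hγ x := by
  set y := T.resolvent γ hγ x with hy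
  -- Integrating this derivative over the half-line gives minus the left side of the claim, while
  -- the boundary values give -y.
  have hder : ∀ s ∈ Ioi (0 : ℝ), HasDerivAt (fun s : ℝ => Real.exp (-β * s) • T.op s.toNNReal y)
      (Real.exp (-β * s) • T.op s.toNNReal (-(x + (β - γ) • y))) s := fun s hs => by
    have h1 := (T.hasDerivWithinAt_op_resolvent hγ x (le_of_lt hs)).hasDerivAt
      (Ici_mem_nhds hs)
    have h2 : HasDerivAt (fun s => Real.exp (-β * s)) (Real.exp (-β * s) * -β) s := by
      simpa using ((hasDerivAt_id s).const_mul (-β)).exp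
    refine (h2.smul h1).congr_deriv ?_
    simp only [map_neg, map_add, map_smul, ← hy]
    module
  have hlim : Tendsto (fun s : ℝ => Real.exp (-β * s) • T.op s.toNNReal y) atTop (𝓝 0) := by
    refine squeeze_zero_norm (T.norm_laplace_le β y) ?_
    have h : Tendsto (fun s : ℝ => Real.exp (-β * s)) atTop (𝓝 0) :=
      Real.tendsto_exp_atBot.comp (tendsto_id.const_mul_atTop_of_neg (by linarith))
    simpa using h.const_mul ‖y‖
  have h := integral_Ioi_of_hasDerivAt_of_tendsto
    (T.continuous_laplace β y).continuousWithinAt hder (T.integrableOn_laplace hβ _) hlim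
  rw [← T.resolvent_apply hβ, map_neg, zero_sub, neg_inj] at h
  simpa [T.op_zero] using h

end Resolvent

/-! ### The adjoint semigroup -/

section Adjoint

variable {H : Type*} [NormedAddCommGroup H] [InnerProductSpace ℝ H] [CompleteSpace H]
  (T : ContractionSemigroup H)

open ContinuousLinearMap in
/-- The semigroup of the adjoint operators. -/
noncomputable def dual : ContractionSemigroup H where
  op t := adjoint (T.op t)
  op_zero := by rw [T.op_zero]; exact adjoint_id
  op_add s t := by rw [add_comm, T.op_add, adjoint_comp]
  norm_op_le t := by rw [LinearIsometryEquiv.norm_map]; exact T.norm_op_le t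
  continuous_op x := by
    have hle : ∀ t z, ‖adjoint (T.op t) z‖ ≤ ‖z‖ := fun t z => by
      have h : ‖adjoint (T.op t)‖ ≤ 1 := by
        rw [LinearIsometryEquiv.norm_map]; exact T.norm_op_le t
      simpa using (adjoint (T.op t)).le_of_opNorm_le h z
    -- Expanding the square and using contractivity gives ‖T'ₜx - x‖² ≤ 2⟨x - Tₜx, x⟩, so continuity
    -- at 0 is inherited from T.
    have h0 : Tendsto (fun t => ‖adjoint (T.op t) x - x‖) (𝓝 0) (𝓝 0) := by
      have h1 : Tendsto (fun t => Real.sqrt (2 * inner ℝ (x - T.op t x) x)) (𝓝 0) (𝓝 0) := by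
        have h2 : Continuous fun t => Real.sqrt (2 * inner ℝ (x - T.op t x) x) := by
          have := T.continuous_op x
          fun_prop
        simpa [T.op_zero] using h2.tendsto 0
      refine squeeze_zero (fun _ => norm_nonneg _) (fun t => Real.le_sqrt_of_sq_le ?_) h1
      rw [norm_sub_sq_real, adjoint_inner_left, inner_sub_left, real_inner_self_eq_norm_sq,
        real_inner_comm]
      nlinarith [hle t x, norm_nonneg (adjoint (T.op t) x)]
    have hdiff : ∀ s t, ‖adjoint (T.op t) x - adjoint (T.op s) x‖
        ≤ ‖adjoint (T.op (nndist t s)) x - x‖ := by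
      have key : ∀ s t, s ≤ t → ‖adjoint (T.op t) x - adjoint (T.op s) x‖
          ≤ ‖adjoint (T.op (nndist t s)) x - x‖ := fun s t hst => by
        have h : t = nndist t s + s := by
          rw [NNReal.nndist_eq, tsub_eq_zero_of_le hst, max_eq_left zero_le,
            tsub_add_cancel_of_le hst]
        conv_lhs => rw [h, T.op_add, adjoint_comp, comp_apply, ← map_sub]
        exact hle _ _
      intro s t
      rcases le_total s t with h | h
      · exact key s t h
      · rw [norm_sub_rev, nndist_comm]
        exact key t s h
    refine continuous_iff_continuousAt.2 fun s => tendsto_iff_norm_sub_tendsto_zero.2 ?_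
    refine squeeze_zero (fun _ => norm_nonneg _) (hdiff s) (h0.comp ?_)
    have : Continuous fun t => nndist t s := by fun_prop
    simpa using this.tendsto s

theorem dual_resolvent {β : ℝ} (hβ : 0 < β) :
    T.dual.resolvent β hβ = ContinuousLinearMap.adjoint (T.resolvent β hβ) := by
  refine ContinuousLinearMap.ext fun x => ext_inner_right ℝ fun z => ?_
  rw [ContinuousLinearMap.adjoint_inner_left, inner_resolvent, real_inner_comm, inner_resolvent]
  refine integral_congr_ae (ae_of_all _ fun t => ?_)
  simp only [dual]
  rw [ContinuousLinearMap.adjoint_inner_left, real_inner_comm]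

end Adjoint

end ContractionSemigroup

/-! ### Averages of orbits against kernels in e⁻ᵗ -/

namespace ContractionSemigroup

section Kernel

variable {H : Type*} [NormedAddCommGroup H] [InnerProductSpace ℝ H] (T : ContractionSemigroup H)
  {q : ℝ → ℝ}

theorem exp_neg_mem_Icc {t : ℝ} (ht : t ∈ Ioi (0 : ℝ)) : Real.exp (-1 * t) ∈ Icc (0 : ℝ) 1 :=
  ⟨(Real.exp_pos _).le, Real.exp_le_one_iff.2 (by linarith [mem_Ioi.1 ht])⟩

theorem integrableOn_kernel (hq : Continuous q) :
    IntegrableOn (fun t : ℝ => Real.exp (-1 * t) * q (Real.exp (-1 * t))) (Ioi 0) := by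
  obtain ⟨M, hM⟩ := isCompact_Icc.exists_bound_of_continuousOn (s := Icc (0 : ℝ) 1) hq.continuousOn
  refine Integrable.mono' ((exp_neg_integrableOn_Ioi 0 one_pos).mul_const M)
    (Continuous.aestronglyMeasurable (by fun_prop))
    ((ae_restrict_iff' measurableSet_Ioi).2 (ae_of_all _ fun t ht => ?_))
  rw [norm_mul, Real.norm_eq_abs (Real.exp _), Real.abs_exp]
  exact mul_le_mul_of_nonneg_left (hM _ (exp_neg_mem_Icc ht)) (Real.exp_pos _).le

theorem integrableOn_kernel_smul (hq : Continuous q) (x : H) :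
    IntegrableOn (fun t : ℝ => (Real.exp (-1 * t) * q (Real.exp (-1 * t))) • T.op t.toNNReal x)
      (Ioi 0) := by
  have h := T.continuous_op_toNNReal x
  refine Integrable.mono' ((integrableOn_kernel hq).norm.mul_const ‖x‖)
    (Continuous.aestronglyMeasurable (by fun_prop)) (ae_of_all _ fun t => ?_)
  rw [norm_smul]
  exact mul_le_mul_of_nonneg_left (T.norm_op_apply_le _ _) (norm_nonneg _)

/-- The weight e⁻ᵗ has mass 1, so the bound does not depend on the semigroup. -/
theorem norm_integral_kernel_sub_le {p : ℝ → ℝ} (hq : Continuous q) (hp : Continuous p) (x : H)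
    {ε : ℝ} (hpq : ∀ s ∈ Icc (0 : ℝ) 1, |p s - q s| ≤ ε) :
    ‖(∫ t in Ioi (0 : ℝ), (Real.exp (-1 * t) * q (Real.exp (-1 * t))) • T.op t.toNNReal x)
      - ∫ t in Ioi (0 : ℝ), (Real.exp (-1 * t) * p (Real.exp (-1 * t))) • T.op t.toNNReal x‖
      ≤ ε * ‖x‖ := by
  rw [← integral_sub (T.integrableOn_kernel_smul hq x) (T.integrableOn_kernel_smul hp x)]
  have h : ∫ t in Ioi (0 : ℝ), Real.exp (-1 * t) * (ε * ‖x‖) = ε * ‖x‖ := by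
    rw [integral_mul_const, integral_exp_neg_mul one_pos, inv_one, one_mul]
  rw [← h]
  refine norm_integral_le_of_norm_le ((exp_neg_integrableOn_Ioi 0 one_pos).mul_const _)
    ((ae_restrict_iff' measurableSet_Ioi).2 (ae_of_all _ fun t ht => ?_))
  rw [← sub_smul, ← mul_sub, norm_smul, norm_mul, Real.norm_eq_abs (Real.exp _), Real.abs_exp,
    mul_assoc, Real.norm_eq_abs, abs_sub_comm]
  have h1 := hpq _ (exp_neg_mem_Icc ht)
  have h2 := T.norm_op_apply_le t.toNNReal x
  have h3 := (abs_nonneg _).trans h1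
  gcongr

/-- With the weight e⁻ᵗ the monomial of degree k becomes e^{-(k+1)t}; the shift keeps the parameter
positive even for the constant term. -/
theorem integral_kernel_polynomial (p : Polynomial ℝ) (x : H) :
    ∫ t in Ioi (0 : ℝ), (Real.exp (-1 * t) * p.eval (Real.exp (-1 * t))) • T.op t.toNNReal x
      = ∑ k ∈ Finset.range (p.natDegree + 1),
        p.coeff k • T.resolvent (k + 1) (by positivity) x := by
  have h : ∀ t : ℝ, (Real.exp (-1 * t) * p.eval (Real.exp (-1 * t))) • T.op t.toNNReal x
      = ∑ k ∈ Finset.range (p.natDegree + 1),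
        p.coeff k • (Real.exp (-(k + 1 : ℝ) * t) • T.op t.toNNReal x) := fun t => by
    rw [Polynomial.eval_eq_sum_range, Finset.mul_sum, Finset.sum_smul]
    refine Finset.sum_congr rfl fun k _ => ?_
    rw [smul_smul, ← Real.exp_nat_mul, mul_left_comm, ← Real.exp_add]
    congr 3
    ring
  simp only [h, resolvent_apply]
  have hi : ∀ k ∈ Finset.range (p.natDegree + 1), IntegrableOn
      (fun t : ℝ => p.coeff k • (Real.exp (-(k + 1 : ℝ) * t) • T.op t.toNNReal x)) (Ioi 0) :=
    fun k _ => (T.integrableOn_laplace (by positivity) x).smul (p.coeff k)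
  rw [integral_finsetSum _ hi]
  exact Finset.sum_congr rfl fun k _ => integral_smul _ _

variable [CompleteSpace H]

/-- Modulus of continuity of an orbit in terms of the distance to the range of the resolvent. -/
theorem norm_op_sub_op_le {β : ℝ} (hβ : 0 < β) (x : H) {δ : ℝ}
    (hδ : ‖β • T.resolvent β hβ x - x‖ ≤ δ) {s t : ℝ} (hs : 0 ≤ s) (ht : 0 ≤ t)
    (hst : |t - s| ≤ β⁻¹) : ‖T.op t.toNNReal x - T.op s.toNNReal x‖ ≤ 3 * δ := by
  set y := T.resolvent β hβ x with hy
  have h1 : ‖T.op t.toNNReal y - T.op s.toNNReal y‖ ≤ δ * β⁻¹ :=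
    (T.norm_op_resolvent_sub_le hβ x hs ht).trans (by gcongr; exact (norm_nonneg _).trans hδ)
  have h2 : β * ‖T.op t.toNNReal y - T.op s.toNNReal y‖ ≤ δ := by
    calc _ ≤ β * (δ * β⁻¹) := by gcongr
      _ = δ := by field_simp
  -- Replacing x by βy costs at most δ at each of the two times; the Lipschitz part is at most δ
  -- because |t - s| ≤ 1/β.
  have h3 : T.op t.toNNReal x - T.op s.toNNReal x = β • (T.op t.toNNReal y - T.op s.toNNReal y)
      - T.op t.toNNReal (β • y - x) + T.op s.toNNReal (β • y - x) := by
    simp only [map_sub, map_smul]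
    module
  have h4 := T.norm_op_apply_le t.toNNReal (β • y - x)
  have h5 := T.norm_op_apply_le s.toNNReal (β • y - x)
  rw [h3]
  refine (norm_add_le _ _).trans ?_
  have h6 := norm_sub_le (β • (T.op t.toNNReal y - T.op s.toNNReal y))
    (T.op t.toNNReal (β • y - x))
  rw [norm_smul, Real.norm_eq_abs, abs_of_pos hβ] at h6
  linarith

end Kernel

end ContractionSemigroup

/-- The mass of a tent function in the variable `exp (-t)`. -/
theorem integral_tent_pos {t₀ η : ℝ} (ht₀ : 0 ≤ t₀) (hη : 0 < η) :
    0 < ∫ t in Ioi (0 : ℝ),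
      Real.exp (-1 * t) * max 0 (η - |Real.exp (-1 * t) - Real.exp (-1 * t₀)|) := by
  have hq : Continuous fun s : ℝ => max 0 (η - |s - Real.exp (-1 * t₀)|) := by fun_prop
  rw [setIntegral_pos_iff_support_of_nonneg_ae
    (ae_of_all _ fun t => mul_nonneg (Real.exp_pos _).le (le_max_left _ _))
    (ContractionSemigroup.integrableOn_kernel (q := fun s => max 0 (η - |s - Real.exp (-1 * t₀)|)) hq)]
  have hcont : Continuous fun t : ℝ => |Real.exp (-1 * t) - Real.exp (-1 * t₀)| := by fun_prop
  have hopen : IsOpen ({t : ℝ | |Real.exp (-1 * t) - Real.exp (-1 * t₀)| < η} ∩ Ioi 0) :=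
    (isOpen_lt hcont continuous_const).inter isOpen_Ioi
  refine (hopen.measure_pos volume ?_).trans_le (measure_mono fun t ht => ⟨?_, ht.2⟩)
  -- Approaching from the right yields a point of the open half-line even when t₀ = 0.
  · have h : ∀ᶠ t in 𝓝[>] t₀, |Real.exp (-1 * t) - Real.exp (-1 * t₀)| < η :=
      (hcont.tendsto t₀).mono_left nhdsWithin_le_nhds |>.eventually_lt_const (by simpa using hη)
    obtain ⟨t, h1, h2⟩ := (h.and self_mem_nhdsWithin).exists
    exact ⟨t, h1, ht₀.trans_lt h2⟩
  · have h : 0 < η - |Real.exp (-1 * t) - Real.exp (-1 * t₀)| := sub_pos.2 ht.1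
    exact (mul_pos (Real.exp_pos _) (h.trans_le (le_max_right _ _))).ne'

/-! ### Trotter–Kato theorem along varying spaces -/

section TrotterKato

variable {H : ℕ → Type*} [∀ n, NormedAddCommGroup (H n)] [∀ n, InnerProductSpace ℝ (H n)]
  {V : Type*} [AddCommGroup V] [Module ℝ V] {J : ∀ n, V →ₗ[ℝ] H n}
  {T : ∀ n, ContractionSemigroup (H n)} {x : ∀ n, H n}

namespace StrongConv

theorem eventually_norm_le (hJ : AsymptoticIsometry J)
    (hx : StrongConv J x) : ∀ᶠ n in atTop, ‖x n‖ ≤ ‖x 0‖ + 1 :=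
  ((hx.tendsto_norm hJ).eventually_lt_const (lt_add_one _)).mono fun _ h => h.le

/-- Polynomial kernels involve only resolvents at 1, 2, …; Weierstrass on [0,1] reaches every
continuous `q`, uniformly in n because the norms of `x n` are eventually bounded. -/
theorem integral_kernel (hJ : AsymptoticIsometry J)
    (hx : StrongConv J x)
    (hG : ∀ (β : ℝ) (hβ : 0 < β), StrongConv J fun n => (T n).resolvent β hβ (x n))
    {q : ℝ → ℝ} (hq : Continuous q) :
    StrongConv J fun n => ∫ t in Ioi (0 : ℝ),
      (Real.exp (-1 * t) * q (Real.exp (-1 * t))) • (T n).op t.toNNReal (x n) := by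
  refine of_approx fun ε hε => ?_
  have hK : 0 < ‖x 0‖ + 1 := by positivity
  obtain ⟨p, hp⟩ := exists_polynomial_near_of_continuousOn 0 1 q hq.continuousOn
    (ε / (‖x 0‖ + 1)) (by positivity)
  have key : ∀ n, ‖x n‖ ≤ ‖x 0‖ + 1 → _ := fun n hn =>
    ((T n).norm_integral_kernel_sub_le hq p.continuous (x n) fun s hs => (hp s hs).le).trans
      (show _ ≤ ε by rw [div_mul_eq_mul_div, div_le_iff₀ hK]; gcongr)
  refine ⟨_, ?_, key 0 (by linarith), (hx.eventually_norm_le hJ).mono key⟩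
  simp only [ContractionSemigroup.integral_kernel_polynomial]
  exact sum _ fun k _ => (hG _ _).smul _

variable [∀ n, CompleteSpace (H n)]

theorem resolvent_of_semigroup (hJ : AsymptoticIsometry J)
    (hT : ∀ t : ℝ≥0, StrongConv J fun n => (T n).op t (x n))
    {β : ℝ} (hβ : 0 < β) : StrongConv J fun n => (T n).resolvent β hβ (x n) := by
  have hx : StrongConv J x := by simpa [(T _).op_zero] using hT 0
  have hxK := hx.eventually_norm_le hJ
  -- Used twice: with z n = J n u for weak convergence, then with the resolvents themselves for
  -- their norms, where the weak limit just found is paired with the strong limit of the orbits.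
  have key : ∀ (z : ∀ n, H n) (K : ℝ), (∀ᶠ n in atTop, ‖z n‖ ≤ K) →
      (∀ t, Tendsto (fun n => inner ℝ ((T n).op t (x n)) (z n)) atTop
        (𝓝 (inner ℝ ((T 0).op t (x 0)) (z 0)))) →
      Tendsto (fun n => inner ℝ ((T n).resolvent β hβ (x n)) (z n)) atTop
        (𝓝 (inner ℝ ((T 0).resolvent β hβ (x 0)) (z 0))) := by
    intro z K hK hz
    simp only [ContractionSemigroup.inner_resolvent]
    refine tendsto_integral_filter_of_dominated_convergence
      (fun t => Real.exp (-β * t) * ((‖x 0‖ + 1) * K)) (Eventually.of_forall fun n => ?_) ?_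
      ((exp_neg_integrableOn_Ioi 0 hβ).mul_const _)
      (ae_of_all _ fun t => (hz t.toNNReal).const_mul _)
    · have := (T n).continuous_op_toNNReal (x n)
      exact Continuous.aestronglyMeasurable (by fun_prop)
    · filter_upwards [hxK, hK] with n h1 h2
      refine ae_of_all _ fun t => ?_
      rw [norm_mul, Real.norm_eq_abs (Real.exp _), Real.abs_exp]
      have h3 := ((T n).norm_op_apply_le t.toNNReal (x n)).trans h1
      have h4 := norm_inner_le_norm (𝕜 := ℝ) ((T n).op t.toNNReal (x n)) (z n)
      refine mul_le_mul_of_nonneg_left (h4.trans ?_) (Real.exp_pos _).le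
      gcongr
  have hw : ∀ u, Tendsto (fun n => inner ℝ ((T n).resolvent β hβ (x n)) (J n u)) atTop
      (𝓝 (inner ℝ ((T 0).resolvent β hβ (x 0)) (J 0 u))) := fun u =>
    key _ _ ((strongConv_apply u).eventually_norm_le hJ)
      fun t => (hT t).tendsto_inner hJ (strongConv_apply u)
  refine of_weak_of_norm hJ hw (key (fun n => (T n).resolvent β hβ (x n))
    (β⁻¹ * (‖x 0‖ + 1)) ?_ fun t => ?_)
  · filter_upwards [hxK] with n hn
    exact ((T n).norm_resolvent_le hβ (x n)).trans (by gcongr)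
  · simp only [real_inner_comm ((T _).resolvent β hβ _)]
    refine (hT t).tendsto_inner_of_weak (K := β⁻¹ * (‖x 0‖ + 1)) ?_ ?_ hw
    · filter_upwards [hxK] with n hn
      exact ((T n).norm_resolvent_le hβ (x n)).trans (by gcongr)
    · exact ((T 0).norm_resolvent_le hβ (x 0)).trans (by gcongr; linarith)

theorem semigroup_of_resolvent (hJ : AsymptoticIsometry J)
    (hx : StrongConv J x)
    (hG : ∀ (β : ℝ) (hβ : 0 < β), StrongConv J fun n => (T n).resolvent β hβ (x n)) (t : ℝ≥0) :
    StrongConv J fun n => (T n).op t (x n) := by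
  refine of_approx fun ε hε => ?_
  -- β is chosen for the limit semigroup alone; norm convergence passes the bound to almost all n.
  -- The third of ε absorbs the factor 3 in `norm_op_sub_op_le`.
  obtain ⟨β, hβ, hβε⟩ := (T 0).exists_norm_smul_resolvent_sub_lt (x 0) (div_pos hε three_pos)
  have hev : ∀ᶠ n in atTop, ‖β • (T n).resolvent β hβ (x n) - x n‖ < ε / 3 :=
    (((hG β hβ).smul β).sub hx |>.tendsto_norm hJ).eventually_lt_const hβε
  have hlog : ∀ᶠ s in 𝓝 (Real.exp (-1 * t)), |-Real.log s - t| < β⁻¹ := by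
    have h1 : ContinuousAt (fun s => |-Real.log s - t|) (Real.exp (-1 * t)) :=
      ((Real.continuousAt_log (Real.exp_pos (-1 * t)).ne').neg.sub continuousAt_const).abs
    exact h1.eventually_lt_const (by simpa using hβ)
  -- With this width the tent only sees times within 1/β of t, where the orbit varies by at most ε.
  obtain ⟨η, hη, hball⟩ := Metric.eventually_nhds_iff.1 hlog
  set q : ℝ → ℝ := fun s => max 0 (η - |s - Real.exp (-1 * t)|)
  have hq : Continuous q := by fun_prop
  set N := ∫ r in Ioi (0 : ℝ), Real.exp (-1 * r) * q (Real.exp (-1 * r)) with hN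
  have hNpos : 0 < N := integral_tent_pos t.2 hη
  have hmass : ∀ n, ‖β • (T n).resolvent β hβ (x n) - x n‖ < ε / 3 →
      ‖(T n).op t (x n) - N⁻¹ • ∫ r in Ioi (0 : ℝ),
        (Real.exp (-1 * r) * q (Real.exp (-1 * r))) • (T n).op r.toNNReal (x n)‖ ≤ ε := by
    intro n hn
    have h1 : (T n).op t (x n) = N⁻¹ • ∫ r in Ioi (0 : ℝ),
        (Real.exp (-1 * r) * q (Real.exp (-1 * r))) • (T n).op t (x n) := by
      rw [integral_smul_const, inv_smul_smul₀ hNpos.ne']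
    have h2 : ‖(∫ r in Ioi (0 : ℝ), (Real.exp (-1 * r) * q (Real.exp (-1 * r))) • (T n).op t (x n))
        - ∫ r in Ioi (0 : ℝ),
          (Real.exp (-1 * r) * q (Real.exp (-1 * r))) • (T n).op r.toNNReal (x n)‖ ≤ N * ε := by
      have hi := ContractionSemigroup.integrableOn_kernel hq
      rw [← integral_sub (hi.smul_const _) ((T n).integrableOn_kernel_smul hq _), hN,
        ← integral_mul_const]
      refine norm_integral_le_of_norm_le (hi.mul_const ε)
        ((ae_restrict_iff' measurableSet_Ioi).2 (ae_of_all _ fun r hr => ?_))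
      have hk : 0 ≤ Real.exp (-1 * r) * q (Real.exp (-1 * r)) :=
        mul_nonneg (Real.exp_pos _).le (le_max_left _ _)
      rw [← smul_sub, norm_smul, Real.norm_eq_abs, abs_of_nonneg hk]
      rcases lt_or_ge |Real.exp (-1 * r) - Real.exp (-1 * t)| η with h | h
      · have h3 := hball (y := Real.exp (-1 * r)) h
        rw [Real.log_exp, neg_mul, one_mul, neg_neg, abs_sub_comm] at h3
        have h4 := (T n).norm_op_sub_op_le hβ (x n) hn.le (le_of_lt hr) t.2 h3.le
        rw [mul_div_cancel₀ _ three_ne_zero, NNReal.val_eq_coe, Real.toNNReal_coe] at h4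
        gcongr
      · have h3 : q (Real.exp (-1 * r)) = 0 := max_eq_left (sub_nonpos.2 h)
        rw [h3, mul_zero, zero_mul, zero_mul]
    conv_lhs => rw [h1]
    rw [← smul_sub, norm_smul, norm_inv, Real.norm_eq_abs, abs_of_pos hNpos,
      inv_mul_le_iff₀ hNpos]
    exact h2
  exact ⟨_, (integral_kernel hJ hx hG hq).smul N⁻¹, hmass 0 hβε, hev.mono hmass⟩

/-- By the resolvent equation G_γ x is the fixed point of w ↦ G_β(x + (β - γ)w), a contraction with
factor |β - γ|/β. The iterates from 0 converge strongly in n, with error geometric in k. -/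
theorem resolvent_of_abs_sub_lt (hJ : AsymptoticIsometry J)
    {β γ : ℝ} (hβ : 0 < β) (hγ : 0 < γ) (hβγ : |β - γ| < β)
    (hG : ∀ x, StrongConv J x → StrongConv J fun n => (T n).resolvent β hβ (x n))
    (hx : StrongConv J x) : StrongConv J fun n => (T n).resolvent γ hγ (x n) := by
  let z : ℕ → ∀ n, H n := fun k => Nat.rec (fun _ => 0)
    (fun _ w n => (T n).resolvent β hβ (x n + (β - γ) • w n)) k
  have hz : ∀ k, StrongConv J (z k) := fun k => by
    induction k with
    | zero => simpa [z] using strongConv_apply (J := J) 0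
    | succ k ih => exact hG _ (hx.add (ih.smul _))
  have hr1 : β⁻¹ * |β - γ| < 1 := by rwa [inv_mul_lt_iff₀ hβ, mul_one]
  have hr0 : 0 ≤ β⁻¹ * |β - γ| := by positivity
  have herr : ∀ k n, ‖(T n).resolvent γ hγ (x n) - z k n‖
      ≤ (β⁻¹ * |β - γ|) ^ k * (γ⁻¹ * ‖x n‖) := fun k n => by
    induction k with
    | zero => simpa [z] using (T n).norm_resolvent_le hγ (x n)
    | succ k ih =>
      have h1 : (T n).resolvent γ hγ (x n) - z (k + 1) n
          = (T n).resolvent β hβ ((β - γ) • ((T n).resolvent γ hγ (x n) - z k n)) := by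
        conv_lhs => rw [← (T n).resolvent_add_smul_resolvent hβ hγ (x n)]
        change _ - (T n).resolvent β hβ (x n + (β - γ) • z k n) = _
        rw [← map_sub]
        congr 1
        module
      have h2 := (T n).norm_resolvent_le hβ ((β - γ) • ((T n).resolvent γ hγ (x n) - z k n))
      rw [norm_smul, Real.norm_eq_abs, ← mul_assoc] at h2
      rw [h1, pow_succ', mul_assoc]
      exact h2.trans (by gcongr)
  refine of_approx fun ε hε => ?_
  have hlim : Tendsto (fun k => (β⁻¹ * |β - γ|) ^ k * (γ⁻¹ * (‖x 0‖ + 1))) atTop (𝓝 0) := by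
    simpa using (tendsto_pow_atTop_nhds_zero_of_lt_one hr0 hr1).mul_const (γ⁻¹ * (‖x 0‖ + 1))
  obtain ⟨k, hk⟩ := (hlim.eventually_lt_const hε).exists
  have key : ∀ n, ‖x n‖ ≤ ‖x 0‖ + 1 → ‖(T n).resolvent γ hγ (x n) - z k n‖ ≤ ε := fun n hn =>
    (herr k n).trans (hk.le.trans' (by gcongr))
  exact ⟨z k, hz k, key 0 (by linarith), (hx.eventually_norm_le hJ).mono key⟩

/-- Strong convergence of the resolvents does not depend on the parameter. -/
theorem resolvent_of_resolvent (hJ : AsymptoticIsometry J)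
    {β γ : ℝ} (hβ : 0 < β) (hγ : 0 < γ)
    (hG : ∀ u, StrongConv J fun n => (T n).resolvent β hβ (J n u))
    (hx : StrongConv J x) : StrongConv J fun n => (T n).resolvent γ hγ (x n) := by
  have hG' : ∀ x, StrongConv J x → StrongConv J fun n => (T n).resolvent β hβ (x n) := fun x hx =>
    hx.comp (fun n z => (T n).norm_resolvent_le hβ z) hG
  -- Every γ below β is reached in one step. Going up, the condition |β - γ| < β allows any ratio
  -- below 2, and 3/2 is used.
  have key : ∀ (k : ℕ) (γ : ℝ) (hγ : 0 < γ), γ < (3 / 2) ^ k * β → ∀ x, StrongConv J x →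
      StrongConv J fun n => (T n).resolvent γ hγ (x n) := by
    intro k
    induction k with
    | zero =>
      intro γ hγ h x hx
      refine resolvent_of_abs_sub_lt hJ hβ hγ ?_ hG' hx
      rw [pow_zero, one_mul] at h
      rw [abs_of_pos (sub_pos.2 h)]
      linarith
    | succ k ih =>
      intro γ hγ h x hx
      rw [pow_succ] at h
      refine resolvent_of_abs_sub_lt hJ (β := 2 / 3 * γ) (by positivity) hγ ?_
        (ih _ (by positivity) (by linarith)) hx
      rw [abs_of_neg (by linarith)]
      linarith
  obtain ⟨k, hk⟩ := pow_unbounded_of_one_lt (γ / β) (by norm_num : (1 : ℝ) < 3 / 2)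
  exact key k γ hγ (by rwa [div_lt_iff₀ hβ] at hk) x hx

end StrongConv

end TrotterKato

/-! ### s-convergence as strong convergence -/

namespace MeasureSequence

variable {E : Type*} [MeasurableSpace E] {S : MeasureSequence E} {F : Submodule ℝ S.interL2}

variable (S F) in
/-- The maps to the spaces `L²(E, νₙ)`, restricted to a subspace. -/
noncomputable def restrictL2 (n : ℕ) : F →ₗ[ℝ] S.L2 n := (S.toL2 n).domRestrict F

theorem tendsto_norm_toL2 {φ : S.interL2} (h : φ ∈ S.D) :
    Tendsto (fun n => ‖S.toL2 n φ‖) atTop (𝓝 ‖S.toL2 0 φ‖) := by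
  have h1 : Tendsto (fun n => inner ℝ (S.toL2 n φ) (S.toL2 n φ)) atTop
    (𝓝 (inner ℝ (S.toL2 0 φ) (S.toL2 0 φ))) := h
  simp only [real_inner_self_eq_norm_sq] at h1
  simpa only [Real.sqrt_sq (norm_nonneg _)] using h1.sqrt

theorem asymptoticIsometry_restrictL2 (hFD : ∀ φ ∈ F, φ ∈ S.D)
    (hFdense : Dense (S.toL2 0 '' (F : Set S.interL2))) :
    AsymptoticIsometry (H := S.L2) (V := F) (S.restrictL2 F) where
  tendsto_norm u := tendsto_norm_toL2 (hFD u u.2)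
  denseRange := by
    have h : range (S.restrictL2 F 0) = S.toL2 0 '' (F : Set S.interL2) := by
      ext; simp [restrictL2]
    rwa [DenseRange, h]

theorem strongConv_of_mem {φ : S.interL2} (hφ : φ ∈ F) :
    StrongConv (H := S.L2) (V := F) (S.restrictL2 F) fun n => S.toL2 n φ :=
  strongConv_apply (H := S.L2) (V := F) (J := S.restrictL2 F) ⟨φ, hφ⟩

variable (hJ : AsymptoticIsometry (H := S.L2) (V := F) (S.restrictL2 F))
include hJ

theorem mem_C_of_mem (hFD : ∀ φ ∈ F, φ ∈ S.D) {φ : S.interL2} (hφ : φ ∈ F) : φ ∈ S.C F :=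
  ⟨hFD φ hφ, ⟨fun _ => φ, fun _ _ => ⟨hφ, rfl⟩⟩, fun _ hψ =>
    (strongConv_of_mem hφ).tendsto_inner hJ (strongConv_of_mem hψ)⟩

theorem strongConv_of_mem_C {φ : S.interL2} (hφ : φ ∈ S.C F) :
    StrongConv (H := S.L2) (V := F) (S.restrictL2 F) fun n => S.toL2 n φ :=
  StrongConv.of_weak_of_norm hJ (fun u => hφ.2.2 u u.2) hφ.1

/-- Testing against `F` ⊆ 𝒞 together with the norms yields strong convergence; conversely every test
function in 𝒞 is itself strongly convergent, so inner products pass to the limit. -/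
theorem sConv_iff (hFD : ∀ φ ∈ F, φ ∈ S.D) {ψ : ∀ n, S.L2 n}
    (hψ : ∀ n, 1 ≤ n → S.InC F n (ψ n)) :
    S.SConv F ψ (ψ 0) ↔ StrongConv (H := S.L2) (V := F) (S.restrictL2 F) ψ := by
  refine ⟨fun h => StrongConv.of_weak_of_norm hJ
    (fun u => h.1.2 u (mem_C_of_mem hJ hFD u.2)) h.2, fun h => ⟨⟨hψ, fun ρ hρ => ?_⟩, ?_⟩⟩
  · exact h.tendsto_inner hJ (strongConv_of_mem_C hJ hρ)
  · exact h.tendsto_inner hJ h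

omit hJ in
/-- Convergence of contraction semigroups and of their resolvents are equivalent, both for a
fixed initial value and all parameters, and for all initial values and a fixed parameter. -/
theorem sConv_resolvent_iff_sConv_semigroup (hFD : ∀ φ ∈ F, φ ∈ S.D)
    (hFdense : Dense (S.toL2 0 '' (F : Set S.interL2)))
    (T : ∀ n, ContractionSemigroup (S.L2 n))
    (hG : ∀ (n : ℕ) (β : ℝ) (hβ : 0 < β), ∀ g ∈ S.C F,
      S.InC F n ((T n).resolvent β hβ (S.toL2 n g)))
    (hT : ∀ (n : ℕ) (t : ℝ≥0), 0 < t → ∀ g ∈ S.C F, S.InC F n ((T n).op t (S.toL2 n g))) :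
    (∀ g ∈ S.C F,
      (∀ (β : ℝ) (hβ : 0 < β), S.SConv F (fun n => (T n).resolvent β hβ (S.toL2 n g))
        ((T 0).resolvent β hβ (S.toL2 0 g))) ↔
      (∀ t : ℝ≥0, S.SConv F (fun n => (T n).op t (S.toL2 n g))
        ((T 0).op t (S.toL2 0 g)))) ∧
    (∀ (β : ℝ) (hβ : 0 < β),
      (∀ g ∈ S.C F, S.SConv F (fun n => (T n).resolvent β hβ (S.toL2 n g))
        ((T 0).resolvent β hβ (S.toL2 0 g))) ↔
      (∀ g ∈ S.C F, ∀ t : ℝ≥0, S.SConv F (fun n => (T n).op t (S.toL2 n g))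
        ((T 0).op t (S.toL2 0 g)))) := by
  have hJ := asymptoticIsometry_restrictL2 hFD hFdense
  have hGiff : ∀ g ∈ S.C F, ∀ (β : ℝ) (hβ : 0 < β),
      S.SConv F (fun n => (T n).resolvent β hβ (S.toL2 n g)) ((T 0).resolvent β hβ (S.toL2 0 g)) ↔
      StrongConv (H := S.L2) (V := F) (S.restrictL2 F)
        fun n => (T n).resolvent β hβ (S.toL2 n g) := fun g hg β hβ =>
    sConv_iff hJ hFD (ψ := fun n => (T n).resolvent β hβ (S.toL2 n g))
      fun n _ => hG n β hβ g hg
  have hTiff : ∀ g ∈ S.C F, ∀ t : ℝ≥0,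
      S.SConv F (fun n => (T n).op t (S.toL2 n g)) ((T 0).op t (S.toL2 0 g)) ↔
      StrongConv (H := S.L2) (V := F) (S.restrictL2 F)
        fun n => (T n).op t (S.toL2 n g) := fun g hg t =>
    sConv_iff hJ hFD (ψ := fun n => (T n).op t (S.toL2 n g)) fun n _ => by
      -- Invariance of 𝒞 is assumed for t > 0 only; at t = 0 the witness is `g`.
      rcases eq_or_ne t 0 with rfl | ht
      · exact ⟨g, hg, by simp [(T n).op_zero]⟩
      · exact hT n t (pos_iff_ne_zero.2 ht) g hg
  refine ⟨fun g hg => ⟨fun h t => ?_, fun h β hβ => ?_⟩,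
    fun β hβ => ⟨fun h g hg t => ?_, fun h g hg => ?_⟩⟩
  · exact (hTiff g hg t).2 (StrongConv.semigroup_of_resolvent hJ
      (strongConv_of_mem_C hJ hg) (fun β hβ => (hGiff g hg β hβ).1 (h β hβ)) t)
  · exact (hGiff g hg β hβ).2 (StrongConv.resolvent_of_semigroup hJ
      (fun t => (hTiff g hg t).1 (h t)) hβ)
  · have hg' := strongConv_of_mem_C hJ hg
    refine (hTiff g hg t).2 (StrongConv.semigroup_of_resolvent hJ hg' (fun γ hγ => ?_) t)
    -- The hypothesis at the single β is needed only on `F`, which lies in 𝒞.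
    refine StrongConv.resolvent_of_resolvent hJ hβ hγ (fun u => ?_) hg'
    have hu := mem_C_of_mem hJ hFD u.2
    exact (hGiff u hu β hβ).1 (h u hu)
  · exact (hGiff g hg β hβ).2 (StrongConv.resolvent_of_semigroup hJ
      (fun t => (hTiff g hg t).1 (h g hg t)) hβ)

end MeasureSequence

theorem theorem2p10 {E : Type*} [MeasurableSpace E] (S : MeasureSequence E)
    (F : Submodule ℝ S.interL2) (hFD : ∀ φ ∈ F, φ ∈ S.D)
    (hFdense : Dense (S.toL2 0 '' (F : Set S.interL2)))
    (T : ∀ n, ContractionSemigroup (S.L2 n))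
    -- the resolvents and the dual resolvents (n = 0: limit; n ≥ 1: sequence) leave 𝒞 invariant
    (hG : ∀ (n : ℕ) (β : ℝ) (hβ : 0 < β), ∀ g ∈ S.C F,
      S.InC F n ((T n).resolvent β hβ (S.toL2 n g)))
    (hG' : ∀ (n : ℕ) (β : ℝ) (hβ : 0 < β), ∀ g ∈ S.C F,
      S.InC F n (ContinuousLinearMap.adjoint ((T n).resolvent β hβ) (S.toL2 n g)))
    -- the semigroups and the dual semigroups leave 𝒞 invariant
    (hT : ∀ (n : ℕ) (t : ℝ≥0), 0 < t → ∀ g ∈ S.C F,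
      S.InC F n ((T n).op t (S.toL2 n g)))
    (hT' : ∀ (n : ℕ) (t : ℝ≥0), 0 < t → ∀ g ∈ S.C F,
      S.InC F n (ContinuousLinearMap.adjoint ((T n).op t) (S.toL2 n g))) :
    -- for each g, with all β
    (∀ g ∈ S.C F,
      (∀ (β : ℝ) (hβ : 0 < β), S.SConv F (fun n => (T n).resolvent β hβ (S.toL2 n g))
        ((T 0).resolvent β hβ (S.toL2 0 g))) ↔
      (∀ t : ℝ≥0, S.SConv F (fun n => (T n).op t (S.toL2 n g))
        ((T 0).op t (S.toL2 0 g)))) ∧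
    -- for each β, with all g
    (∀ (β : ℝ) (hβ : 0 < β),
      (∀ g ∈ S.C F, S.SConv F (fun n => (T n).resolvent β hβ (S.toL2 n g))
        ((T 0).resolvent β hβ (S.toL2 0 g))) ↔
      (∀ g ∈ S.C F, ∀ t : ℝ≥0, S.SConv F (fun n => (T n).op t (S.toL2 n g))
        ((T 0).op t (S.toL2 0 g)))) ∧
    -- the same two equivalences for the dual operators
    (∀ g ∈ S.C F,
      (∀ (β : ℝ) (hβ : 0 < β), S.SConv F
        (fun n => ContinuousLinearMap.adjoint ((T n).resolvent β hβ) (S.toL2 n g))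
        (ContinuousLinearMap.adjoint ((T 0).resolvent β hβ) (S.toL2 0 g))) ↔
      (∀ t : ℝ≥0, S.SConv F
        (fun n => ContinuousLinearMap.adjoint ((T n).op t) (S.toL2 n g))
        (ContinuousLinearMap.adjoint ((T 0).op t) (S.toL2 0 g)))) ∧
    (∀ (β : ℝ) (hβ : 0 < β),
      (∀ g ∈ S.C F, S.SConv F
        (fun n => ContinuousLinearMap.adjoint ((T n).resolvent β hβ) (S.toL2 n g))
        (ContinuousLinearMap.adjoint ((T 0).resolvent β hβ) (S.toL2 0 g))) ↔
      (∀ g ∈ S.C F, ∀ t : ℝ≥0, S.SConv F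
        (fun n => ContinuousLinearMap.adjoint ((T n).op t) (S.toL2 n g))
        (ContinuousLinearMap.adjoint ((T 0).op t) (S.toL2 0 g)))) := by
  have h := MeasureSequence.sConv_resolvent_iff_sConv_semigroup hFD hFdense T hG hT
  have h' := MeasureSequence.sConv_resolvent_iff_sConv_semigroup hFD hFdense
    (fun n => (T n).dual)
    (fun n β hβ g hg => by rw [ContractionSemigroup.dual_resolvent]; exact hG' n β hβ g hg) hT'
  simp only [ContractionSemigroup.dual_resolvent] at h'
  exact ⟨h.1, h.2, h'.1, h'.2⟩
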